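/- Let $d\ge 3$ and let $P$ be a simplicial $d$-polytope, that is, the convex hull of a finite set of points in some $\mathbb{R}^n$, of dimension $d$, such that every facet (face of dimension $d-1$) of $P$ is a simplex, meaning a polytope whose face lattice is isomorphic to that of the convex hull of finitely many affinely independent points. Let $G$ be the graph of $P$: its vertices are the vertices ($0$-dimensional faces) of $P$ and its edges are the edges ($1$-dimensional faces) of $P$. An edge cut of $G$ is a set of the form $\mathcal{E}(X,\mathcal{V}(G)\setminus X)$, the set of all edges of $G$ joining a vertex in $X$ to a vertex not in $X$, where $X$ is a nonempty proper subset of the vertex set $\mathcal{V}(G)$; a minimum edge cut is an edge cut with the least number of edges among all edge cuts of $G$. Then every minimum edge cut of $G$ with at most $4d-7$ edges is trivial, that is, it is the set of all edges of $G$ incident with some single vertex. -/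

import Mathlib

namespace SimplicialPolytope

section Polytopes

variable {E : Type*} [AddCommGroup E] [Module ℝ E]

/-- A (convex) polytope: the convex hull of a finite set of points. -/
def IsPolytope (P : Set E) : Prop :=
  ∃ S : Set E, S.Finite ∧ P = convexHull ℝ S

/-- A nonempty set `F` has dimension `k` if its affine hull has dimension `k`, equivalently if
`k + 1` is the maximum number of affinely independent points in `F`. The empty set has no
dimension in this sense. -/
def HasDim (F : Set E) (k : ℕ) : Prop :=
  F.Nonempty ∧ Module.finrank ℝ (vectorSpan ℝ F) = k

/-- `F` is a face of `P`: the set of points of `P` at which some linear inequality `l x ≤ c`, valid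
on `P`, holds with equality. For `l ≠ 0` this is the intersection of `P` with a hyperplane having
`P` in one of its closed half-spaces; `l = 0`, `c = 0` gives the face `P` itself, and `l = 0`,
`c = 1` the empty face. -/
def IsFace (P F : Set E) : Prop :=
  ∃ (l : E →ₗ[ℝ] ℝ) (c : ℝ), (∀ x ∈ P, l x ≤ c) ∧ F = {x ∈ P | l x = c}

/-- The faces of `P`, ordered by inclusion (the order on a subtype of `Set E`): the face lattice. -/
abbrev FaceLattice (P : Set E) : Type _ := {F : Set E // IsFace P F}

/-- Two polytopes are combinatorially isomorphic if their face lattices are isomorphic. -/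
def CombIso {E' : Type*} [AddCommGroup E'] [Module ℝ E'] (P : Set E) (Q : Set E') : Prop :=
  Nonempty (FaceLattice P ≃o FaceLattice Q)

/-- A simplex: a polytope that is combinatorially isomorphic to the convex hull of some nonempty
finite affinely independent family of points. -/
def IsSimplex (F : Set E) : Prop :=
  IsPolytope F ∧ ∃ (k : ℕ) (p : Fin (k + 1) → E),
    AffineIndependent ℝ p ∧ CombIso F (convexHull ℝ (Set.range p))

/-- A facet of a `d`-polytope `P`: a face of dimension `d - 1`. -/
def IsFacet (d : ℕ) (P F : Set E) : Prop :=
  IsFace P F ∧ ∃ k : ℕ, k + 1 = d ∧ HasDim F k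

/-- A simplicial `d`-polytope: a polytope of dimension `d` all of whose facets are simplices. -/
structure IsSimplicialPolytope (d : ℕ) (P : Set E) : Prop where
  isPolytope : IsPolytope P
  hasDim : HasDim P d
  isSimplex_of_isFacet : ∀ F : Set E, IsFacet d P F → IsSimplex F

/-- The vertices of `P`: the points `v` such that `{v}` is a (necessarily zero-dimensional) face. -/
abbrev Vertex (P : Set E) : Type _ := {v : E // IsFace P {v}}

/-- The graph of `P`: two distinct vertices are adjacent if they lie in a common edge of `P`, that
is, in a common face of dimension `1` (of which they are then the two end points). -/
def graph (P : Set E) : SimpleGraph (Vertex P) where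
  Adj u v := u ≠ v ∧ ∃ F : Set E, IsFace P F ∧ HasDim F 1 ∧ (u : E) ∈ F ∧ (v : E) ∈ F
  symm := ⟨fun _ _ ⟨hne, F, hF, hd, hu, hv⟩ => ⟨hne.symm, F, hF, hd, hv, hu⟩⟩
  loopless := ⟨fun _ h => h.1 rfl⟩

end Polytopes

section EdgeCuts

variable {V : Type*} (G : SimpleGraph V)

/-- The set of all edges of `G` from a vertex of `X` to a vertex outside `X`. -/
def edgesBetween (X : Set V) : Set (Sym2 V) :=
  {e | ∃ x ∈ X, ∃ y ∉ X, G.Adj x y ∧ e = s(x, y)}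

/-- `D` is an edge cut of `G`: the set of edges between some nonempty proper subset of the vertices
and its complement. (Such a set meets every path from inside `X` to outside `X`, so it is
automatically separating.) -/
def IsEdgeCut (D : Set (Sym2 V)) : Prop :=
  ∃ X : Set V, X.Nonempty ∧ X ≠ Set.univ ∧ D = edgesBetween G X

/-- A minimum edge cut: an edge cut of least cardinality among all edge cuts. -/
def IsMinimumEdgeCut (D : Set (Sym2 V)) : Prop :=
  IsEdgeCut G D ∧ ∀ D' : Set (Sym2 V), IsEdgeCut G D' → D.encard ≤ D'.encard

/-- `D` is trivial: it consists of all the edges incident with a single vertex. -/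
def IsTrivialCut (D : Set (Sym2 V)) : Prop :=
  ∃ v : V, D = G.incidenceSet v

end EdgeCuts

end SimplicialPolytope

/-!
A nontrivial minimum edge cut of a simplicial `d`-polytope with `d ≥ 3` has at least `d (d + 1) / 2`
edges, and `d (d + 1) / 2 > 4 d - 7` for every `d`.

Let `B` be the bipartite graph of the `k` edges between `X` and its complement, where both sides
have at least two vertices. Three facts carry the bound.

* Adjacent vertices of the polytope have at least `d - 1` common neighbours
  (`IsSimplicialPolytope.le_ncard_commonNeighbors`), because an edge lies in two distinct facets and
  the vertices of a facet are pairwise adjacent. A common neighbour of the ends `x`, `y` of an edge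
  of `B` is joined within `B` to one of them, so `deg_B x + deg_B y ≥ d + 1`.
* Every vertex cover of `B` has at least `d` vertices. By minimality of the cut all degrees are at
  least `k`, which forces both sides to have at least `k ≥ d` vertices
  (`card_edgeFinset_cutGraph_le`). A smaller cover would thus contain neither side, and deleting it
  would disconnect the graph, against Balinski's theorem (`IsPolytope.preconnected_induce_compl`).
* For `0 ≤ t ≤ d`, the vertices of `X` with `deg_B > t` and those outside `X` with `deg_B > d - t`
  form a vertex cover of `B`, by the first fact. Adding up the sizes of these `d + 1` covers gives
  `(d + 1) d ≤ ∑ deg_B = 2 k` (`mul_le_two_mul_card_edgeFinset`).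

The facts about polytopes rest on pivoting (`exists_pivot`): a functional nonnegative on the
vertices stays so while a multiple of a second one is subtracted, until a new vertex becomes
a zero. This produces larger faces from faces of codimension at least two
(`IsFace.exists_ssuperset`), second facets through a face (`IsFacet.exists_isFacet_not_subset`), and
the edges along which a functional improves (`IsPolytope.exists_improving_edge`), from
which Balinski's theorem follows.
-/

namespace SimplicialPolytope

/-! ### Faces of convex hulls of finite sets -/

section Faces

variable {E : Type*} [AddCommGroup E] [Module ℝ E]

/-- The set of vertices of `P`, as points of the ambient space. -/
def verts (P : Set E) : Set E := {v | IsFace P {v}}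

theorem IsFace.subset {P F : Set E} (h : IsFace P F) : F ⊆ P := by
  obtain ⟨l, c, -, rfl⟩ := h
  exact Set.sep_subset _ _

theorem isFace_self (P : Set E) : IsFace P P := ⟨0, 0, by simp, by simp⟩

theorem isFace_empty (P : Set E) : IsFace P ∅ := ⟨0, 1, by simp, by simp⟩

/-- A face of `P` that lies in a subset `F` of `P` is a face of `F`. -/
theorem IsFace.restrict {P F G : Set E} (hG : IsFace P G) (hFP : F ⊆ P) (hGF : G ⊆ F) :
    IsFace F G := by
  obtain ⟨l, c, hl, rfl⟩ := hG
  refine ⟨l, c, fun x hx => hl x (hFP hx), ?_⟩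
  ext x
  exact ⟨fun hx => ⟨hGF hx, hx.2⟩, fun hx => ⟨hFP hx.1, hx.2⟩⟩

theorem mem_of_mem_verts {P : Set E} {v : E} (hv : v ∈ verts P) : v ∈ P :=
  IsFace.subset hv rfl

theorem le_of_mem_convexHull {S : Set E} {l : E →ₗ[ℝ] ℝ} {c : ℝ} (h : ∀ s ∈ S, l s ≤ c) :
    ∀ x ∈ convexHull ℝ S, l x ≤ c := fun _ hx =>
  convexHull_min (t := {x | l x ≤ c}) h (convex_halfSpace_le l.isLinear c) hx

/-- A supporting hyperplane meets `convexHull ℝ S` in the hull of the points of `S` on it: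
the points of the half-space that lie in this hull if they lie on the hyperplane form a convex set
containing `S`. -/
theorem sep_convexHull_eq {S : Set E} {l : E →ₗ[ℝ] ℝ} {c : ℝ} (h : ∀ s ∈ S, l s ≤ c) :
    {x ∈ convexHull ℝ S | l x = c} = convexHull ℝ {s ∈ S | l s = c} := by
  apply Set.Subset.antisymm
  · rintro x ⟨hx, hxc⟩
    have key : convexHull ℝ S ⊆ {x | l x ≤ c ∧ (l x = c → x ∈ convexHull ℝ {s ∈ S | l s = c})} := by
      apply convexHull_min
      · exact fun s hs => ⟨h s hs, fun hsc => subset_convexHull _ _ ⟨hs, hsc⟩⟩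
      · rintro x ⟨hx1, hx2⟩ y ⟨hy1, hy2⟩ a b ha hb hab
        simp only [Set.mem_ofPred_eq, map_add, map_smul, smul_eq_mul]
        have habc : a * c + b * c = c := by rw [← add_mul, hab, one_mul]
        refine ⟨by linarith [mul_le_mul_of_nonneg_left hx1 ha, mul_le_mul_of_nonneg_left hy1 hb],
          fun heq => ?_⟩
        rcases ha.eq_or_lt with rfl | ha
        · obtain rfl : b = 1 := by linarith
          simpa using hy2 (by simpa using heq)
        rcases hb.eq_or_lt with rfl | hb
        · obtain rfl : a = 1 := by linarith
          simpa using hx2 (by simpa using heq)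
        have hxc : l x = c := by
          by_contra hne
          have := mul_lt_mul_of_pos_left (lt_of_le_of_ne hx1 hne) ha
          have := mul_le_mul_of_nonneg_left hy1 hb.le
          linarith
        have hyc : l y = c := by
          rw [hxc] at heq
          exact mul_left_cancel₀ hb.ne' (by linarith)
        exact convex_convexHull ℝ _ (hx2 hxc) (hy2 hyc) ha.le hb.le hab
    exact (key hx).2 hxc
  · intro x hx
    refine ⟨convexHull_mono (Set.sep_subset _ _) hx, ?_⟩
    exact convexHull_min (t := {x | l x = c}) (fun s hs => hs.2) (convex_hyperplane l.isLinear c) hx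

theorem isFace_convexHull {S : Set E} {l : E →ₗ[ℝ] ℝ} {c : ℝ} (h : ∀ s ∈ S, l s ≤ c) :
    IsFace (convexHull ℝ S) (convexHull ℝ {s ∈ S | l s = c}) :=
  ⟨l, c, le_of_mem_convexHull h, (sep_convexHull_eq h).symm⟩

theorem IsFace.isPolytope {P F : Set E} (hP : IsPolytope P) (hF : IsFace P F) : IsPolytope F := by
  obtain ⟨S, hS, rfl⟩ := hP
  obtain ⟨l, c, hl, rfl⟩ := hF
  exact ⟨_, hS.subset (Set.sep_subset _ _),
    sep_convexHull_eq fun s hs => hl s (subset_convexHull _ _ hs)⟩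

/-- Some real `N` exceeds `g / f` on a finite set wherever `f` is positive. -/
theorem exists_mul_gt {ι : Type*} {S : Set ι} (hS : S.Finite) (f g : ι → ℝ) :
    ∃ N : ℝ, ∀ s ∈ S, 0 < f s → g s < N * f s := by
  obtain ⟨M, hM⟩ := (hS.image fun s => g s / f s).bddAbove
  refine ⟨M + 1, fun s hs hf => ?_⟩
  rw [← div_lt_iff₀ hf]
  have : g s / f s ≤ M := hM ⟨s, hs, rfl⟩
  linarith

/-- A face of a face of a polytope is a face. If `l` and `m` define the two faces, then
`N • l + m` with `N` large defines the smaller one. -/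
theorem IsFace.trans {P F G : Set E} (hP : IsPolytope P) (hF : IsFace P F) (hG : IsFace F G) :
    IsFace P G := by
  obtain ⟨S, hS, rfl⟩ := hP
  obtain ⟨l, c, hl, rfl⟩ := hF
  obtain ⟨m, b, hm, rfl⟩ := hG
  have hl' : ∀ s ∈ S, l s ≤ c := fun s hs => hl s (subset_convexHull _ _ hs)
  rw [sep_convexHull_eq hl'] at hm ⊢
  have hm' : ∀ s ∈ {s ∈ S | l s = c}, m s ≤ b := fun s hs => hm s (subset_convexHull _ _ hs)
  rw [sep_convexHull_eq hm']
  obtain ⟨N, hN⟩ := exists_mul_gt hS (fun s => c - l s) (fun s => m s - b)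
  have hle : ∀ s ∈ S, (N • l + m) s ≤ N * c + b := by
    intro s hs
    simp only [LinearMap.add_apply, LinearMap.smul_apply, smul_eq_mul]
    rcases (hl' s hs).eq_or_lt with h | h
    · rw [h]; linarith [hm' s ⟨hs, h⟩]
    · linarith [hN s hs (by linarith)]
  convert isFace_convexHull hle using 2
  ext s
  simp only [Set.mem_ofPred_eq, LinearMap.add_apply, LinearMap.smul_apply, smul_eq_mul]
  constructor
  · rintro ⟨⟨hs, h1⟩, h2⟩
    exact ⟨hs, by rw [h1, h2]⟩
  · rintro ⟨hs, h⟩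
    rcases (hl' s hs).eq_or_lt with h1 | h1
    · rw [h1] at h
      exact ⟨⟨hs, h1⟩, by linarith⟩
    · linarith [hN s hs (by linarith)]

theorem verts_convexHull_subset (S : Set E) : verts (convexHull ℝ S) ⊆ S := by
  rintro v ⟨l, c, hl, hv⟩
  rw [sep_convexHull_eq fun s hs => hl s (subset_convexHull _ _ hs)] at hv
  have hne : (convexHull ℝ {s ∈ S | l s = c}).Nonempty := hv ▸ Set.singleton_nonempty v
  obtain ⟨s, hs⟩ := convexHull_nonempty_iff.mp hne
  have : s ∈ ({v} : Set E) := hv ▸ subset_convexHull _ _ hs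
  exact Set.mem_singleton_iff.mp this ▸ hs.1

theorem IsPolytope.finite_verts {P : Set E} (hP : IsPolytope P) : (verts P).Finite := by
  obtain ⟨S, hS, rfl⟩ := hP
  exact hS.subset (verts_convexHull_subset S)

theorem verts_eq_of_isFace {P F : Set E} (hP : IsPolytope P) (hF : IsFace P F) :
    verts F = verts P ∩ F := by
  ext v
  exact ⟨fun hv => ⟨hF.trans hP hv, mem_of_mem_verts hv⟩, fun hv =>
    IsFace.restrict hv.1 hF.subset (Set.singleton_subset_iff.mpr hv.2)⟩

/-- The pivot step of the simplex method: the least ratio `f v / g v` over the points with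
`0 < g v`. -/
theorem exists_pivot {ι : Type*} {V : Set ι} (hV : V.Finite) {f g : ι → ℝ}
    (hf : ∀ v ∈ V, 0 ≤ f v) (hg : ∃ v ∈ V, 0 < g v) :
    ∃ t : ℝ, 0 ≤ t ∧ (∀ v ∈ V, t * g v ≤ f v) ∧ ∃ v ∈ V, 0 < g v ∧ f v = t * g v := by
  obtain ⟨v₀, hv₀, hgv₀⟩ := hg
  obtain ⟨v, ⟨hv, hgv⟩, hmin⟩ := Set.exists_min_image {v ∈ V | 0 < g v} (fun v => f v / g v)
    (hV.subset (Set.sep_subset _ _)) ⟨v₀, hv₀, hgv₀⟩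
  have ht : 0 ≤ f v / g v := div_nonneg (hf v hv) hgv.le
  refine ⟨f v / g v, ht, fun w hw => ?_, v, hv, hgv, by field_simp⟩
  rcases lt_or_ge 0 (g w) with h | h
  · rw [← le_div_iff₀ h]
    exact hmin w ⟨hw, h⟩
  · exact (mul_nonpos_of_nonneg_of_nonpos ht h).trans (hf w hw)

end Faces

/-! ### Polytopes and their vertices -/

section Polytopes

variable {E : Type*} [NormedAddCommGroup E] [NormedSpace ℝ E]

/-- A polytope is the convex hull of its vertices. In a minimal finite generating set, every point
is strictly separated from the hull of the others, hence is a vertex. -/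
theorem IsPolytope.convexHull_verts {P : Set E} (hP : IsPolytope P) :
    convexHull ℝ (verts P) = P := by
  obtain ⟨S, hS, rfl⟩ := hP
  obtain ⟨T, hTS, hT⟩ := exists_minimal_le_of_wellFoundedLT
    (fun T : Finset E => convexHull ℝ (T : Set E) = convexHull ℝ S) hS.toFinset (by simp)
  rw [← hT.prop]
  refine Set.Subset.antisymm
    (convexHull_min (fun v hv => mem_of_mem_verts hv) (convex_convexHull ℝ _))
    (convexHull_mono fun s hs => ?_)
  classical
  have hs' : s ∉ convexHull ℝ ((T.erase s : Finset E) : Set E) := by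
    intro hmem
    have heq : convexHull ℝ ((T.erase s : Finset E) : Set E) = convexHull ℝ (T : Set E) := by
      refine Set.Subset.antisymm (convexHull_mono (by simp))
        (convexHull_min (fun x hx => ?_) (convex_convexHull ℝ _))
      by_cases hxs : x = s
      · exact hxs ▸ hmem
      · exact subset_convexHull _ _ (by simpa using ⟨hx, hxs⟩)
    have := hT.le_of_le (heq.trans hT.prop) (Finset.erase_subset s T) hs
    simp at this
  obtain ⟨l, u, hlu, hus⟩ := geometric_hahn_banach_closed_point (convex_convexHull ℝ _)
    ((T.erase s).finite_toSet.isCompact_convexHull (𝕜 := ℝ)).isClosed hs'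
  have hlt : ∀ x ∈ (T : Set E), x ≠ s → l x < l s := fun x hx hxs =>
    (hlu x (subset_convexHull _ _ (by simpa using ⟨hx, hxs⟩))).trans hus
  have hle : ∀ x ∈ (T : Set E), (l : E →ₗ[ℝ] ℝ) x ≤ l s := fun x hx => by
    rcases eq_or_ne x s with rfl | h
    · exact le_rfl
    · exact (hlt x hx h).le
  have hface := isFace_convexHull hle
  have : {x ∈ (T : Set E) | (l : E →ₗ[ℝ] ℝ) x = l s} = {s} := by
    ext x
    simp only [Set.mem_ofPred_eq, Set.mem_singleton_iff]
    refine ⟨fun ⟨hx, hxs⟩ => by_contra fun h => (hlt x hx h).ne hxs, ?_⟩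
    rintro rfl
    exact ⟨hs, rfl⟩
  rwa [this, convexHull_singleton] at hface

theorem IsFace.convexHull_verts_inter {P F : Set E} (hP : IsPolytope P) (hF : IsFace P F) :
    convexHull ℝ (verts P ∩ F) = F := by
  rw [← verts_eq_of_isFace hP hF, (hF.isPolytope hP).convexHull_verts]

theorem IsPolytope.finite_setOf_isFace {P : Set E} (hP : IsPolytope P) :
    {F | IsFace P F}.Finite := by
  refine (hP.finite_verts.finite_subsets.image (convexHull ℝ)).subset fun F hF => ?_
  exact ⟨verts P ∩ F, Set.inter_subset_left, hF.convexHull_verts_inter hP⟩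

theorem IsPolytope.nonempty_verts {P : Set E} (hP : IsPolytope P) (hne : P.Nonempty) :
    (verts P).Nonempty := by
  rw [← hP.convexHull_verts] at hne
  exact convexHull_nonempty_iff.mp hne

/-- A linear functional exceeds a value on a polytope only if it does so at a vertex. -/
theorem IsPolytope.exists_vert_gt {P : Set E} (hP : IsPolytope P) {l : E →ₗ[ℝ] ℝ} {c : ℝ}
    (h : ∃ x ∈ P, c < l x) : ∃ v ∈ verts P, c < l v := by
  by_contra! hcon
  obtain ⟨x, hx, hcx⟩ := h
  rw [← hP.convexHull_verts] at hx
  exact absurd (le_of_mem_convexHull hcon x hx) (not_le.mpr hcx)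

/-- To define a face of a polytope it is enough to bound a functional on the vertices. -/
theorem IsPolytope.isFace_sep {P : Set E} (hP : IsPolytope P) {l : E →ₗ[ℝ] ℝ} {c : ℝ}
    (h : ∀ v ∈ verts P, l v ≤ c) : IsFace P {x ∈ P | l x = c} := by
  refine ⟨l, c, ?_, rfl⟩
  rw [← hP.convexHull_verts]
  exact le_of_mem_convexHull h

theorem vectorSpan_convexHull (S : Set E) : vectorSpan ℝ (convexHull ℝ S) = vectorSpan ℝ S := by
  rw [← direction_affineSpan, affineSpan_convexHull, direction_affineSpan]

theorem map_eq_of_vectorSpan_le_ker {S : Set E} {l : E →ₗ[ℝ] ℝ} (h : vectorSpan ℝ S ≤ l.ker)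
    {x y : E} (hx : x ∈ S) (hy : y ∈ S) : l x = l y := by
  have := h (vsub_mem_vectorSpan ℝ hx hy)
  rwa [LinearMap.mem_ker, vsub_eq_sub, map_sub, sub_eq_zero] at this

theorem vectorSpan_le_ker {S : Set E} {l : E →ₗ[ℝ] ℝ} {c : ℝ} (h : ∀ x ∈ S, l x = c) :
    vectorSpan ℝ S ≤ l.ker := by
  rw [vectorSpan_def, Submodule.span_le]
  rintro _ ⟨x, hx, y, hy, rfl⟩
  simp [h x hx, h y hy]

theorem IsPolytope.finrank_vectorSpan_lt_ncard_verts {P : Set E} (hP : IsPolytope P)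
    (hne : P.Nonempty) : Module.finrank ℝ (vectorSpan ℝ P) < (verts P).ncard := by
  conv_lhs => rw [← hP.convexHull_verts, vectorSpan_convexHull]
  have : Fintype (verts P) := hP.finite_verts.fintype
  have : Nonempty (verts P) := (hP.nonempty_verts hne).to_subtype
  have h := finrank_vectorSpan_range_add_one_le ℝ (Subtype.val : verts P → E)
  rwa [Subtype.range_coe, ← Nat.card_eq_fintype_card, Nat.card_coe_set_eq] at h

/-! ### Facets and improving edges -/

variable [FiniteDimensional ℝ E]

theorem exists_linearMap_of_finrank_lt {W D : Submodule ℝ E}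
    (h : Module.finrank ℝ W < Module.finrank ℝ D) :
    ∃ m : E →ₗ[ℝ] ℝ, W ≤ m.ker ∧ ¬ D ≤ m.ker := by
  have : ¬ D ≤ W := fun hle => absurd (Submodule.finrank_mono hle) (not_le.mpr h)
  obtain ⟨x, hxD, hxW⟩ := Set.not_subset.mp this
  obtain ⟨m, hm, hW⟩ := Submodule.exists_le_ker_of_notMem hxW
  exact ⟨m, hW, fun hD => hm (hD hxD)⟩

/-- A face of codimension at least two lies in a larger proper face: its supporting hyperplane can
be rotated about the face, keeping a chosen point off the hyperplane, until it hits another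
vertex. -/
theorem IsFace.exists_ssuperset {P G : Set E} (hP : IsPolytope P) (hG : IsFace P G)
    (hne : G.Nonempty)
    (hdim : Module.finrank ℝ (vectorSpan ℝ G) + 1 < Module.finrank ℝ (vectorSpan ℝ P)) :
    ∃ G', IsFace P G' ∧ G ⊂ G' ∧ G' ≠ P := by
  have hGP : G ≠ P := by rintro rfl; omega
  obtain ⟨p, hpP, hpG⟩ := Set.exists_of_ssubset (hG.subset.ssubset_of_ne hGP)
  obtain ⟨a, ha⟩ := hne
  have hfr : Module.finrank ℝ ↥(vectorSpan ℝ G ⊔ Submodule.span ℝ {p - a}) <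
      Module.finrank ℝ (vectorSpan ℝ P) := by
    have h1 := Submodule.finrank_add_le_finrank_add_finrank (vectorSpan ℝ G)
      (Submodule.span ℝ {p - a})
    have h2 := finrank_span_le_card (R := ℝ) ({p - a} : Set E)
    simp only [Set.toFinset_singleton, Finset.card_singleton] at h2
    omega
  obtain ⟨m, hm, hmP⟩ := exists_linearMap_of_finrank_lt hfr
  have hmG : ∀ x ∈ G, m x = m a := fun x hx =>
    map_eq_of_vectorSpan_le_ker (le_sup_left.trans hm) hx ha
  have hmp : m p = m a := by
    have := hm (Submodule.mem_sup_right (Submodule.mem_span_singleton_self (p - a)))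
    rwa [LinearMap.mem_ker, map_sub, sub_eq_zero] at this
  -- Up to replacing `m` by `-m`, some vertex has a larger value than the face.
  have hm' : ∃ m : E →ₗ[ℝ] ℝ, (∀ x ∈ G, m x = m a) ∧ m p = m a ∧ ∃ v ∈ verts P, m a < m v := by
    obtain ⟨q, hq, hqa⟩ : ∃ q ∈ P, m q ≠ m a := by
      by_contra! h
      exact hmP (vectorSpan_le_ker h)
    rcases hqa.lt_or_gt with h | h
    · exact ⟨-m, by simpa using hmG, by simpa using hmp,
        hP.exists_vert_gt ⟨q, hq, by simpa using h⟩⟩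
    · exact ⟨m, hmG, hmp, hP.exists_vert_gt ⟨q, hq, h⟩⟩
  clear hmG hmp hmP hm hfr m
  obtain ⟨m, hmG, hmp, v₀, hv₀, hmv₀⟩ := hm'
  obtain ⟨l, c, hl, rfl⟩ := hG
  obtain ⟨t, -, hle, v, hv, hmv, hvt⟩ := exists_pivot hP.finite_verts
    (f := fun x => c - l x) (g := fun x => m x - m a)
    (fun x hx => sub_nonneg.mpr (hl x (mem_of_mem_verts hx))) ⟨v₀, hv₀, sub_pos.mpr hmv₀⟩
  refine ⟨_, hP.isFace_sep (l := l + t • m) (c := c + t * m a) (fun x hx => ?_),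
    (Set.ssubset_iff_of_subset ?_).mpr ⟨v, ⟨mem_of_mem_verts hv, ?_⟩, ?_⟩, ?_⟩
  · have := hle x hx
    simp only [LinearMap.add_apply, LinearMap.smul_apply, smul_eq_mul]
    linarith
  · intro x hx
    refine ⟨hx.1, ?_⟩
    simp [hx.2, hmG x hx]
  · simp only [LinearMap.add_apply, LinearMap.smul_apply, smul_eq_mul]
    linarith
  · intro hvG
    exact hmv.ne' (sub_eq_zero.mpr (hmG v hvG))
  · intro heq
    have hp : p ∈ {x ∈ P | (l + t • m) x = c + t * m a} := heq.symm.subset hpP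
    have h2 := hp.2
    simp only [LinearMap.add_apply, LinearMap.smul_apply, smul_eq_mul, hmp] at h2
    exact hpG ⟨hpP, by linarith⟩

/-- Maximal proper faces are facets, so every nonempty proper face lies in a facet. -/
theorem IsFace.exists_isFacet {d : ℕ} {P G : Set E} (hP : IsPolytope P) (hd : HasDim P d)
    (hG : IsFace P G) (hne : G.Nonempty) (hGP : G ≠ P) : ∃ F, IsFacet d P F ∧ G ⊆ F ∧ F ≠ P := by
  have hfin : {F | IsFace P F ∧ F ≠ P}.Finite := hP.finite_setOf_isFace.subset fun F hF => hF.1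
  obtain ⟨F, hGF, hF⟩ := hfin.exists_le_maximal (show G ∈ _ from ⟨hG, hGP⟩)
  refine ⟨F, ⟨hF.prop.1, d - 1, ?_⟩, hGF, hF.prop.2⟩
  have h1 : d ≤ Module.finrank ℝ (vectorSpan ℝ F) + 1 := by
    by_contra! h
    obtain ⟨G', hG', hFG', hG'P⟩ := hF.prop.1.exists_ssuperset hP (hne.mono hGF) (hd.2.symm ▸ h)
    exact hFG'.not_subset (hF.le_of_ge ⟨hG', hG'P⟩ hFG'.subset)
  have h2 : Module.finrank ℝ (vectorSpan ℝ F) < d := by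
    rw [← hd.2]
    refine Submodule.finrank_lt_finrank_of_lt
      ((vectorSpan_mono ℝ hF.prop.1.subset).lt_of_not_ge fun hle => hF.prop.2 ?_)
    obtain ⟨l, c, hl, hFeq⟩ := hF.prop.1
    have hker : vectorSpan ℝ P ≤ l.ker :=
      hle.trans (vectorSpan_le_ker (c := c) fun x hx => by rw [hFeq] at hx; exact hx.2)
    obtain ⟨a, ha⟩ := hne.mono hGF
    rw [hFeq] at ha
    rw [hFeq]
    exact Set.Subset.antisymm (Set.sep_subset _ _) fun x hx =>
      ⟨hx, (map_eq_of_vectorSpan_le_ker hker hx ha.1).trans ha.2⟩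
  exact ⟨by omega, hne.mono hGF, by omega⟩

/-- The simplex method: a vertex at which a linear functional is not maximal lies on an edge along
which the functional increases. A minimal face through `v` on which the functional exceeds
its value at `v` must have dimension one. -/
theorem IsPolytope.exists_improving_edge {P : Set E} (hP : IsPolytope P) {v : E} (hv : v ∈ verts P)
    {l : E →ₗ[ℝ] ℝ} (h : ∃ x ∈ P, l v < l x) :
    ∃ F, IsFace P F ∧ HasDim F 1 ∧ v ∈ F ∧ ∃ u ∈ verts P, u ∈ F ∧ l v < l u := by
  have hfin : {F | IsFace P F ∧ v ∈ F ∧ ∃ x ∈ F, l v < l x}.Finite :=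
    hP.finite_setOf_isFace.subset fun F hF => hF.1
  obtain ⟨F, -, hF⟩ := hfin.exists_le_minimal
    (show P ∈ _ from ⟨isFace_self P, mem_of_mem_verts hv, h⟩)
  obtain ⟨hFP, hvF, x, hx, hlx⟩ := hF.prop
  have hFpoly := hFP.isPolytope hP
  have hvertF := verts_eq_of_isFace hP hFP
  obtain ⟨u, hu, hlu⟩ := hFpoly.exists_vert_gt ⟨x, hx, hlx⟩
  refine ⟨F, hFP, ⟨⟨v, hvF⟩, ?_⟩, hvF, u, (hvertF ▸ hu).1, (hvertF ▸ hu).2, hlu⟩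
  have hvert : v ∈ verts F := hvertF ▸ ⟨hv, hvF⟩
  have hpos : 0 < Module.finrank ℝ (vectorSpan ℝ F) := by
    have hne : u - v ≠ 0 := by
      intro h0
      rw [sub_eq_zero.mp h0] at hlu
      exact lt_irrefl _ hlu
    have := vsub_mem_vectorSpan ℝ (mem_of_mem_verts hu) hvF
    rw [Module.finrank_pos_iff_exists_ne_zero]
    exact ⟨⟨_, this⟩, fun h0 => hne (congrArg Subtype.val h0)⟩
  by_contra hne1
  obtain ⟨G, hG, hvG, hGF⟩ := IsFace.exists_ssuperset hFpoly hvert (Set.singleton_nonempty v)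
    (by rw [vectorSpan_singleton, finrank_bot]; omega)
  obtain ⟨f, c, hf, hfv⟩ := id hvert
  have hfv' : v ∈ {x ∈ F | f x = c} := hfv ▸ rfl
  have hflt : ∀ w ∈ F, w ≠ v → f w < c := fun w hw hwv =>
    (hf w hw).lt_of_ne fun hwc => hwv (by
      have : w ∈ ({v} : Set E) := hfv ▸ ⟨hw, hwc⟩
      exact this)
  obtain ⟨t, ht, hle, w, hw, hlw, hwt⟩ := exists_pivot hFpoly.finite_verts
    (f := fun x => c - f x) (g := fun x => l x - l v)
    (fun x hx => sub_nonneg.mpr (hf x (mem_of_mem_verts hx))) ⟨u, hu, sub_pos.mpr hlu⟩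
  have hface : IsFace F {x ∈ F | (f + t • l) x = c + t * l v} := hFpoly.isFace_sep fun x hx => by
    have := hle x hx
    simp only [LinearMap.add_apply, LinearMap.smul_apply, smul_eq_mul]
    linarith
  -- By minimality the pivoted hyperplane contains all of `F`.
  have hFle : F ⊆ {x ∈ F | (f + t • l) x = c + t * l v} := by
    refine hF.le_of_le ⟨hFP.trans hP hface, ⟨hvF, ?_⟩, w, ⟨mem_of_mem_verts hw, ?_⟩,
      sub_pos.mp hlw⟩ (Set.sep_subset _ _)
    · simp [hfv'.2]
    · simp only [LinearMap.add_apply, LinearMap.smul_apply, smul_eq_mul]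
      linarith
  -- So `l` exceeds `l v` on all of `F` but `v`, and every face larger than `{v}` qualifies.
  obtain ⟨y, hyG, hyv⟩ := Set.exists_of_ssubset hvG
  have hly : l v < l y := by
    have h1 := (hFle (hG.subset hyG)).2
    simp only [LinearMap.add_apply, LinearMap.smul_apply, smul_eq_mul] at h1
    have h2 := hflt y (hG.subset hyG) hyv
    have h3 : 0 < t * (l y - l v) := by linarith
    exact sub_pos.mp (pos_of_mul_pos_right h3 ht)
  exact hGF (hG.subset.antisymm (hF.le_of_le
    ⟨hFP.trans hP hG, hvG.subset rfl, y, hyG, hly⟩ hG.subset))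

end Polytopes

/-! ### Edges of simplices -/

section Simplices

variable {E : Type*} [NormedAddCommGroup E] [NormedSpace ℝ E]

/-- Any two points of an affinely independent family span a face of the hull of the family. -/
theorem isFace_pair_of_affineIndependent {ι : Type*} {p : ι → E} (hp : AffineIndependent ℝ p)
    (i j : ι) : ∃ F, IsFace (convexHull ℝ (Set.range p)) F ∧ p i ∈ F ∧ p j ∈ F ∧
      ∀ k, p k ∈ F → k = i ∨ k = j := by
  classical
  have hlin := (affineIndependent_iff_linearIndependent_vsub ℝ p i).mp hp
  obtain ⟨m, hm⟩ := LinearMap.exists_extend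
    ((Module.Basis.span hlin).constr ℝ fun k : {k // k ≠ i} => if k.1 = j then (0 : ℝ) else -1)
  have hmk : ∀ k, k ≠ i → m (p k) = m (p i) + if k = j then (0 : ℝ) else -1 := by
    intro k hk
    have h1 := LinearMap.congr_fun hm (Module.Basis.span hlin ⟨k, hk⟩)
    rw [Module.Basis.constr_basis] at h1
    simp only [LinearMap.comp_apply, Submodule.subtype_apply, Module.Basis.span_apply, vsub_eq_sub,
      map_sub] at h1
    linarith
  have hle : ∀ s ∈ Set.range p, m s ≤ m (p i) := by
    rintro _ ⟨k, rfl⟩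
    by_cases hk : k = i
    · rw [hk]
    · rw [hmk k hk]; split_ifs <;> linarith
  refine ⟨_, ⟨m, m (p i), le_of_mem_convexHull hle, rfl⟩, ⟨subset_convexHull _ _ ⟨i, rfl⟩, rfl⟩,
    ⟨subset_convexHull _ _ ⟨j, rfl⟩, ?_⟩, ?_⟩
  · by_cases hji : j = i
    · rw [hji]
    · rw [hmk j hji]; simp
  · rintro k ⟨-, hk⟩
    by_contra! hcon
    rw [hmk k hcon.1, if_neg hcon.2] at hk
    linarith

/-- An isomorphism of face lattices of polytopes sends vertices to vertices. -/
theorem exists_vert_of_orderIso {E' : Type*} [NormedAddCommGroup E'] [NormedSpace ℝ E']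
    {P : Set E} {Q : Set E'} (hQ : IsPolytope Q)
    (φ : FaceLattice P ≃o FaceLattice Q) {v : E} (hv : v ∈ verts P) :
    ∃ q ∈ verts Q, (φ ⟨{v}, hv⟩ : Set E') = {q} := by
  have hne : (φ ⟨{v}, hv⟩ : Set E').Nonempty := by
    rw [Set.nonempty_iff_ne_empty]
    intro h0
    have hle : φ ⟨{v}, hv⟩ ≤ φ ⟨∅, isFace_empty P⟩ := by
      rw [← Subtype.coe_le_coe, h0]
      exact Set.empty_subset _
    exact (Set.singleton_nonempty v).ne_empty (Set.subset_empty_iff.mp (φ.le_iff_le.mp hle))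
  have hface := (φ ⟨{v}, hv⟩).2
  obtain ⟨q, hq⟩ := (hface.isPolytope hQ).nonempty_verts hne
  have hqQ := hq
  rw [verts_eq_of_isFace hQ hface] at hqQ
  refine ⟨q, hqQ.1, ?_⟩
  have hle : φ.symm ⟨{q}, hqQ.1⟩ ≤ ⟨{v}, hv⟩ := by
    rw [OrderIso.symm_apply_le, ← Subtype.coe_le_coe]
    exact Set.singleton_subset_iff.mpr hqQ.2
  rcases Set.subset_singleton_iff_eq.mp (Subtype.coe_le_coe.mpr hle) with h | h
  · exfalso
    have hle' : φ.symm ⟨{q}, hqQ.1⟩ ≤ φ.symm ⟨∅, isFace_empty Q⟩ := by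
      rw [← Subtype.coe_le_coe, h]
      exact Set.empty_subset _
    exact (Set.singleton_nonempty q).ne_empty
      (Set.subset_empty_iff.mp (φ.symm.le_iff_le.mp hle'))
  · have : φ.symm ⟨{q}, hqQ.1⟩ = ⟨{v}, hv⟩ := Subtype.ext h
    rw [← this, OrderIso.apply_symm_apply]

theorem finrank_vectorSpan_pair {u v : E} (h : u ≠ v) :
    Module.finrank ℝ (vectorSpan ℝ (convexHull ℝ {u, v})) = 1 := by
  rw [vectorSpan_convexHull, vectorSpan_pair]
  exact finrank_span_singleton (vsub_ne_zero.mpr h)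

/-- In a simplex, any two vertices are joined by an edge. -/
theorem IsSimplex.exists_edge {F : Set E} (hF : IsSimplex F) {u v : E} (hu : u ∈ verts F)
    (hv : v ∈ verts F) (huv : u ≠ v) : ∃ e, IsFace F e ∧ HasDim e 1 ∧ u ∈ e ∧ v ∈ e := by
  obtain ⟨hpoly, k, p, hp, ⟨φ⟩⟩ := hF
  have hQ : IsPolytope (convexHull ℝ (Set.range p)) := ⟨_, Set.finite_range p, rfl⟩
  have hvert : ∀ w (hw : w ∈ verts F), ∃ i, (φ ⟨{w}, hw⟩ : Set E) = {p i} := by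
    intro w hw
    obtain ⟨q, hq, hφ⟩ := exists_vert_of_orderIso hQ φ hw
    obtain ⟨i, rfl⟩ := verts_convexHull_subset _ hq
    exact ⟨i, hφ⟩
  obtain ⟨i, hi⟩ := hvert u hu
  obtain ⟨j, hj⟩ := hvert v hv
  obtain ⟨e', he', hie, hje, honly⟩ := isFace_pair_of_affineIndependent hp i j
  set e := φ.symm ⟨e', he'⟩ with hedef
  have hmem : ∀ w (hw : w ∈ verts F) (a : Fin (k + 1)), (φ ⟨{w}, hw⟩ : Set E) = {p a} →
      (w ∈ (e : Set E) ↔ p a ∈ e') := by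
    intro w hw a ha
    have : (⟨{w}, hw⟩ : FaceLattice F) ≤ e ↔ φ ⟨{w}, hw⟩ ≤ ⟨e', he'⟩ := by
      rw [hedef, OrderIso.le_symm_apply]
    rw [← Subtype.coe_le_coe, ← Subtype.coe_le_coe, ha] at this
    simpa using this
  have hue := (hmem u hu i hi).mpr hie
  have hve := (hmem v hv j hj).mpr hje
  have hverts : verts F ∩ e = {u, v} := by
    ext w
    constructor
    · rintro ⟨hw, hwe⟩
      obtain ⟨a, ha⟩ := hvert w hw
      rcases honly a ((hmem w hw a ha).mp hwe) with rfl | rfl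
      · left
        have := φ.injective (Subtype.ext (ha.trans hi.symm))
        simpa using congrArg Subtype.val this
      · right
        have := φ.injective (Subtype.ext (ha.trans hj.symm))
        simpa using congrArg Subtype.val this
    · rintro (rfl | rfl)
      · exact ⟨hu, hue⟩
      · exact ⟨hv, hve⟩
  refine ⟨e, e.2, ⟨⟨u, hue⟩, ?_⟩, hue, hve⟩
  rw [← e.2.convexHull_verts_inter hpoly, hverts]
  exact finrank_vectorSpan_pair huv

end Simplices

/-! ### Graphs of polytopes -/

section PolytopeGraph

variable {E : Type*} [NormedAddCommGroup E] [NormedSpace ℝ E]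

theorem IsPolytope.finite_vertex {P : Set E} (hP : IsPolytope P) : Finite (Vertex P) :=
  hP.finite_verts

theorem IsSimplicialPolytope.adj_of_mem_isFacet {d : ℕ} {P F : Set E}
    (hP : IsSimplicialPolytope d P) (hF : IsFacet d P F) {u v : Vertex P} (hu : (u : E) ∈ F)
    (hv : (v : E) ∈ F) (huv : u ≠ v) : (graph P).Adj u v := by
  have hverts := verts_eq_of_isFace hP.isPolytope hF.1
  obtain ⟨e, he, hde, hue, hve⟩ := (hP.isSimplex_of_isFacet F hF).exists_edge
    (hverts ▸ ⟨u.2, hu⟩) (hverts ▸ ⟨v.2, hv⟩) (fun h => huv (Subtype.ext h))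
  exact ⟨huv, e, hF.1.trans hP.isPolytope he, hde, hue, hve⟩

theorem IsFace.lt_ncard_of_hasDim {P F : Set E} {k : ℕ} (hP : IsPolytope P) (hF : IsFace P F)
    (hk : HasDim F k) : k < {v : Vertex P | (v : E) ∈ F}.ncard := by
  have h := (hF.isPolytope hP).finrank_vectorSpan_lt_ncard_verts hk.1
  rw [hk.2, verts_eq_of_isFace hP hF] at h
  rw [← Set.ncard_image_of_injective _ Subtype.val_injective]
  convert h
  ext x
  constructor
  · rintro ⟨v, hv, rfl⟩
    exact ⟨v.2, hv⟩
  · rintro ⟨hx, hxF⟩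
    exact ⟨⟨x, hx⟩, hxF, rfl⟩

variable [FiniteDimensional ℝ E]

theorem IsPolytope.exists_adj_lt {P : Set E} (hP : IsPolytope P) (v : Vertex P) {l : E →ₗ[ℝ] ℝ}
    (h : ∃ x ∈ P, l v < l x) : ∃ u, (graph P).Adj v u ∧ l v < l u := by
  obtain ⟨F, hF, hd, hv, u, hu, huF, hlu⟩ := hP.exists_improving_edge v.2 h
  refine ⟨⟨u, hu⟩, ⟨?_, F, hF, hd, hv, huF⟩, hlu⟩
  rintro rfl
  exact lt_irrefl _ hlu

/-- Vertices outside `C`, on the side of a hyperplane whose open side misses `C`, are all connected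
to one vertex `w` without passing through `C`. They climb along `l`; ties are broken by a functional
`m` exposing a vertex `w` of greatest `l`-value, through `N • l + m` with `N` large, so that
the climb can only stop at `w`. -/
theorem IsPolytope.exists_reachable_of_le {P : Set E} (hP : IsPolytope P) {l : E →ₗ[ℝ] ℝ} {c : ℝ}
    {C : Set (Vertex P)} (hC : ∀ x ∈ C, l x ≤ c) (hex : ∃ x ∈ P, c < l x) :
    ∃ w : ↥Cᶜ, ∀ v : ↥Cᶜ, c ≤ l v → ((graph P).induce Cᶜ).Reachable v w := by
  have hfin := hP.finite_vertex
  obtain ⟨q, hq, hcq⟩ := hP.exists_vert_gt hex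
  have : Nonempty (Vertex P) := ⟨⟨q, hq⟩⟩
  obtain ⟨w, hw⟩ := Finite.exists_max fun v : Vertex P => l v
  have hcw : c < l w := hcq.trans_le (hw ⟨q, hq⟩)
  have hwC : w ∉ C := fun h => (hC w h).not_gt hcw
  obtain ⟨m, b, hm, hmw⟩ := w.2
  have hlt : ∀ v : Vertex P, v ≠ w → m v < m w := by
    intro v hv
    have hwb : (w : E) ∈ {x ∈ P | m x = b} := hmw ▸ rfl
    rw [hwb.2]
    refine (hm v (mem_of_mem_verts v.2)).lt_of_ne fun h => hv (Subtype.ext ?_)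
    have : (v : E) ∈ ({(w : E)} : Set E) := hmw ▸ ⟨mem_of_mem_verts v.2, h⟩
    exact this
  obtain ⟨N, hN⟩ := exists_mul_gt (Set.finite_univ (α := Vertex P × Vertex P))
    (fun p => l p.2 - l p.1) (fun p => m p.1 - m p.2)
  set l' := N • l + m with hl'
  have hl'lt : ∀ u v : Vertex P, l u < l v → l' u < l' v := by
    intro u v huv
    have := hN (u, v) trivial (sub_pos.mpr huv)
    simp only [hl', LinearMap.add_apply, LinearMap.smul_apply, smul_eq_mul]
    linarith
  have hl'w : ∀ v : Vertex P, v ≠ w → l' v < l' w := by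
    intro v hv
    rcases (hw v).lt_or_eq with h | h
    · exact hl'lt v w h
    · simp only [hl', LinearMap.add_apply, LinearMap.smul_apply, smul_eq_mul, h]
      linarith [hlt v hv]
  have hmain : ∀ v : ↥Cᶜ, c < l v → ((graph P).induce Cᶜ).Reachable v ⟨w, hwC⟩ := by
    by_contra! hbad
    obtain ⟨v, ⟨hcv, hvr⟩, hmax⟩ := Set.exists_max_image
      {v : ↥Cᶜ | c < l v ∧ ¬ ((graph P).induce Cᶜ).Reachable v ⟨w, hwC⟩} (fun v => l' v)
      (Set.toFinite _) hbad
    have hvw : (v : Vertex P) ≠ w := by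
      intro h
      exact hvr ((Subtype.ext h : v = ⟨w, hwC⟩) ▸ SimpleGraph.Reachable.refl _)
    obtain ⟨u, hadj, hu⟩ := hP.exists_adj_lt v.1 ⟨w, mem_of_mem_verts w.2, hl'w v hvw⟩
    have hcu : c < l u := hcv.trans_le (not_lt.mp fun h => (hl'lt u v h).not_gt hu)
    have huC : u ∉ C := fun h => (hC u h).not_gt hcu
    have hvu : ((graph P).induce Cᶜ).Reachable v ⟨u, huC⟩ := SimpleGraph.Adj.reachable hadj
    exact (hmax ⟨u, huC⟩ ⟨hcu, fun h => hvr (hvu.trans h)⟩).not_gt hu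
  refine ⟨⟨w, hwC⟩, fun v hv => ?_⟩
  rcases hv.lt_or_eq with h | h
  · exact hmain v h
  · obtain ⟨u, hadj, hu⟩ := hP.exists_adj_lt v.1 ⟨w, mem_of_mem_verts w.2, h ▸ hcw⟩
    have huC : u ∉ C := fun h' => (hC u h').not_gt (h ▸ hu)
    have hvu : ((graph P).induce Cᶜ).Reachable v ⟨u, huC⟩ := SimpleGraph.Adj.reachable hadj
    exact hvu.trans (hmain ⟨u, huC⟩ (h ▸ hu))

/-- Balinski's theorem: the graph of a `d`-polytope stays connected when fewer than `d` vertices are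
deleted. A vertex `u` that is not deleted lies together with the deleted set `C` in a hyperplane not
containing the polytope; on either side of it all vertices are joined to `u`. -/
theorem IsPolytope.preconnected_induce_compl {P : Set E} {d : ℕ} (hP : IsPolytope P)
    (hd : HasDim P d) {C : Set (Vertex P)} (hC : C.ncard < d) :
    ((graph P).induce Cᶜ).Preconnected := by
  have hfin := hP.finite_vertex
  intro u v
  obtain ⟨l, hl, hlP⟩ : ∃ l : E →ₗ[ℝ] ℝ,
      vectorSpan ℝ (Subtype.val '' insert (u : Vertex P) C) ≤ l.ker ∧ ¬ vectorSpan ℝ P ≤ l.ker := by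
    apply exists_linearMap_of_finrank_lt
    have : Fintype ↥(insert (u : Vertex P) C) := Fintype.ofFinite _
    have h := finrank_vectorSpan_range_add_one_le ℝ
      (fun x : ↥(insert (u : Vertex P) C) => ((x : Vertex P) : E))
    rw [← Nat.card_eq_fintype_card, Nat.card_coe_set_eq, Set.ncard_insert_of_notMem u.2] at h
    rw [Set.image_eq_range, hd.2]
    omega
  have hlC : ∀ x ∈ C, l x = l u := fun x hx => map_eq_of_vectorSpan_le_ker hl
    ⟨x, Set.mem_insert_of_mem _ hx, rfl⟩ ⟨u, Set.mem_insert _ _, rfl⟩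
  have hup : (∃ x ∈ P, l u < l x) → l u ≤ l v → ((graph P).induce Cᶜ).Reachable u v := by
    intro h huv
    obtain ⟨w, hw⟩ := hP.exists_reachable_of_le (fun x hx => (hlC x hx).le) h
    exact (hw u le_rfl).trans (hw v huv).symm
  have hdown : (∃ x ∈ P, l x < l u) → l v ≤ l u → ((graph P).induce Cᶜ).Reachable u v := by
    intro h huv
    obtain ⟨w, hw⟩ := hP.exists_reachable_of_le (l := -l) (c := -l u)
      (fun x hx => by simp [hlC x hx]) (by simpa using h)
    exact (hw u le_rfl).trans (hw v (by simpa using huv)).symm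
  obtain ⟨q, hq, hqu⟩ : ∃ q ∈ P, l q ≠ l u := by
    by_contra! h
    exact hlP (vectorSpan_le_ker h)
  have hvP : ((v : Vertex P) : E) ∈ P := mem_of_mem_verts v.1.2
  rcases lt_trichotomy (l u) (l v) with h | h | h
  · exact hup ⟨v, hvP, h⟩ h.le
  · rcases hqu.lt_or_gt with hq' | hq'
    · exact hdown ⟨q, hq, hq'⟩ h.ge
    · exact hup ⟨q, hq, hq'⟩ h.le
  · exact hdown ⟨v, hvP, h⟩ h.le

/-- A face strictly inside a facet `F` lies in a second facet: pivoting its supporting hyperplane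
away from `F` yields a proper face with a vertex outside `F`. -/
theorem IsFacet.exists_isFacet_not_subset {d : ℕ} {P F e : Set E} (hP : IsPolytope P)
    (hd : HasDim P d) (hF : IsFacet d P F) (hFP : F ≠ P) (he : IsFace P e) (hne : e.Nonempty)
    (heF : e ⊂ F) : ∃ F', IsFacet d P F' ∧ e ⊆ F' ∧ ∃ v ∈ verts P, v ∈ F' ∧ v ∉ F := by
  obtain ⟨y, hyF, hye⟩ := Set.exists_of_ssubset heF
  have hv₀ : ∃ v ∈ verts P, v ∉ F := by
    by_contra! h
    have := hF.1.convexHull_verts_inter hP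
    rw [Set.inter_eq_left.mpr h, hP.convexHull_verts] at this
    exact hFP this.symm
  obtain ⟨v₀, hv₀, hv₀F⟩ := hv₀
  obtain ⟨l, c, hl, rfl⟩ := he
  obtain ⟨m, b, hm, hFm⟩ := id hF.1
  have hmF : ∀ x ∈ F, m x = b := fun x hx => by rw [hFm] at hx; exact hx.2
  have hgv₀ : 0 < b - m v₀ := sub_pos.mpr ((hm _ (mem_of_mem_verts hv₀)).lt_of_ne fun h =>
    hv₀F (by rw [hFm]; exact ⟨mem_of_mem_verts hv₀, h⟩))
  obtain ⟨t, -, hle, v, hv, hmv, hvt⟩ := exists_pivot hP.finite_verts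
    (f := fun x => c - l x) (g := fun x => b - m x)
    (fun x hx => sub_nonneg.mpr (hl x (mem_of_mem_verts hx))) ⟨v₀, hv₀, hgv₀⟩
  have hG : IsFace P {x ∈ P | (l - t • m) x = c - t * b} := hP.isFace_sep fun x hx => by
    have := hle x hx
    simp only [LinearMap.sub_apply, LinearMap.smul_apply, smul_eq_mul]
    linarith
  have heG : {x ∈ P | l x = c} ⊆ {x ∈ P | (l - t • m) x = c - t * b} := fun x hx =>
    ⟨hx.1, by simp [hx.2, hmF x (heF.subset hx)]⟩
  have hGP : {x ∈ P | (l - t • m) x = c - t * b} ≠ P := by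
    intro h
    have hy := (h.symm.subset (hF.1.subset hyF)).2
    simp only [LinearMap.sub_apply, LinearMap.smul_apply, smul_eq_mul, hmF y hyF] at hy
    exact hye ⟨hF.1.subset hyF, by linarith⟩
  obtain ⟨F', hF', hGF', -⟩ := hG.exists_isFacet hP hd (hne.mono heG) hGP
  refine ⟨F', hF', heG.trans hGF', v, hv, hGF' ⟨mem_of_mem_verts hv, ?_⟩, fun hvF => ?_⟩
  · simp only [LinearMap.sub_apply, LinearMap.smul_apply, smul_eq_mul]
    linarith
  · rw [hmF v hvF, sub_self] at hmv
    exact lt_irrefl _ hmv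

/-- In a simplicial `d`-polytope, two adjacent vertices have at least `d - 1` common neighbours:
the other vertices of a facet through the edge, and a vertex of a second facet through it. -/
theorem IsSimplicialPolytope.le_ncard_commonNeighbors {d : ℕ} {P : Set E} (hd : 3 ≤ d)
    (hP : IsSimplicialPolytope d P) {x y : Vertex P} (hxy : (graph P).Adj x y) :
    d - 1 ≤ ((graph P).commonNeighbors x y).ncard := by
  have hpoly := hP.isPolytope
  have hfin := hpoly.finite_vertex
  obtain ⟨hne, e, he, hde, hxe, hye⟩ := hxy
  have heP : e ≠ P := by
    rintro rfl
    have := hde.2.symm.trans hP.hasDim.2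
    omega
  obtain ⟨F, hF, heF, hFP⟩ := he.exists_isFacet hpoly hP.hasDim hde.1 heP
  obtain ⟨k, hk, hFk⟩ := id hF.2
  have heF' : e ≠ F := by
    rintro rfl
    have := hde.2.symm.trans hFk.2
    omega
  obtain ⟨F', hF', heF', z, hz, hzF', hzF⟩ := hF.exists_isFacet_not_subset hpoly hP.hasDim hFP he
    hde.1 (heF.ssubset_of_ne heF')
  have hcard := hF.1.lt_ncard_of_hasDim hpoly hFk
  set A := {v : Vertex P | (v : E) ∈ F} with hA
  have hsub : insert ⟨z, hz⟩ (A \ {x, y}) ⊆ (graph P).commonNeighbors x y := by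
    have hzx : ∀ a : Vertex P, (a : E) ∈ e → a ≠ ⟨z, hz⟩ := by
      rintro a ha rfl
      exact hzF (heF ha)
    rintro v (rfl | ⟨hvA, hv⟩)
    · exact ⟨hP.adj_of_mem_isFacet hF' (heF' hxe) hzF' (hzx x hxe),
        hP.adj_of_mem_isFacet hF' (heF' hye) hzF' (hzx y hye)⟩
    · simp only [Set.mem_insert_iff, Set.mem_singleton_iff, not_or] at hv
      exact ⟨hP.adj_of_mem_isFacet hF (heF hxe) hvA (Ne.symm hv.1),
        hP.adj_of_mem_isFacet hF (heF hye) hvA (Ne.symm hv.2)⟩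
  have h1 := Set.ncard_le_ncard hsub (Set.toFinite _)
  rw [Set.ncard_insert_of_notMem (fun h => hzF h.1) (Set.toFinite _)] at h1
  have h2 := Set.le_ncard_sdiff {x, y} A
  rw [Set.ncard_pair hne] at h2
  omega

end PolytopeGraph

/-! ### Edge cuts of finite graphs -/

section Cuts

variable {V : Type*}

/-- The bipartite graph formed by the edges of `G` between `X` and its complement. -/
def cutGraph (G : SimpleGraph V) (X : Set V) : SimpleGraph V where
  Adj v w := G.Adj v w ∧ (v ∈ X ↔ w ∉ X)
  symm := ⟨fun _ _ h => ⟨h.1.symm, by tauto⟩⟩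
  loopless := ⟨fun _ h => G.loopless.irrefl _ h.1⟩

theorem edgeSet_cutGraph (G : SimpleGraph V) (X : Set V) :
    (cutGraph G X).edgeSet = edgesBetween G X := by
  ext e
  induction e with | _ v w => ?_
  rw [SimpleGraph.mem_edgeSet]
  constructor
  · rintro ⟨hadj, hX⟩
    by_cases hv : v ∈ X
    · exact ⟨v, hv, w, hX.mp hv, hadj, rfl⟩
    · exact ⟨w, by tauto, v, hv, hadj.symm, Sym2.eq_swap⟩
  · rintro ⟨x, hx, y, hy, hadj, heq⟩
    rcases Sym2.eq_iff.mp heq with ⟨rfl, rfl⟩ | ⟨rfl, rfl⟩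
    · exact ⟨hadj, by tauto⟩
    · exact ⟨hadj.symm, by tauto⟩

theorem cutGraph_compl (G : SimpleGraph V) (X : Set V) : cutGraph G Xᶜ = cutGraph G X := by
  ext v w
  simp only [cutGraph, Set.mem_compl_iff]
  tauto

theorem isBipartiteWith_cutGraph (G : SimpleGraph V) (X : Set V) :
    (cutGraph G X).IsBipartiteWith X Xᶜ where
  disjoint := disjoint_compl_right
  mem_of_adj v w h := by
    have := h.2
    simp only [Set.mem_compl_iff]
    tauto

theorem edgesBetween_singleton (G : SimpleGraph V) (v : V) :
    edgesBetween G {v} = G.incidenceSet v := by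
  ext e
  constructor
  · rintro ⟨_, rfl, y, -, hadj, rfl⟩
    exact (G.mk'_mem_incidenceSet_left_iff).mpr hadj
  · rintro ⟨he, hv⟩
    obtain ⟨w, rfl⟩ := Sym2.mem_iff_exists.mp hv
    exact ⟨v, rfl, w, fun h => G.ne_of_adj he (Set.mem_singleton_iff.mp h).symm, he, rfl⟩

theorem edgesBetween_compl (G : SimpleGraph V) (X : Set V) :
    edgesBetween G Xᶜ = edgesBetween G X := by
  rw [← edgeSet_cutGraph, cutGraph_compl, edgeSet_cutGraph]

theorem exists_cutGraph_adj {G : SimpleGraph V} {X C : Set V}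
    (h : (G.induce Cᶜ).Preconnected) {a b : V} (ha : a ∈ X) (hb : b ∉ X) (haC : a ∉ C)
    (hbC : b ∉ C) : ∃ u v, u ∉ C ∧ v ∉ C ∧ (cutGraph G X).Adj u v := by
  obtain ⟨p⟩ := h ⟨a, haC⟩ ⟨b, hbC⟩
  obtain ⟨e, -, he1, he2⟩ := p.exists_boundary_dart (Subtype.val ⁻¹' X) ha hb
  exact ⟨e.fst, e.snd, e.fst.2, e.snd.2, e.adj, iff_of_true he1 he2⟩

variable [Fintype V]

open Classical in
/-- A weighted form of König's theorem. If degrees of adjacent vertices add up to more than `d`,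
then for every `t ≤ d` the vertices of `X` of degree greater than `t` and the vertices outside
`X` of degree greater than `d - t` cover all edges. Summing the sizes of these `d + 1` covers
counts each vertex at most as often as its degree. -/
theorem mul_le_two_mul_card_edgeFinset {H : SimpleGraph V} {X : Set V}
    (hX : H.IsBipartiteWith X Xᶜ) {d : ℕ}
    (hdeg : ∀ u v, H.Adj u v → d + 1 ≤ H.degree u + H.degree v)
    (hcov : ∀ C : Set V, H.IsVertexCover C → d ≤ C.ncard) :
    (d + 1) * d ≤ 2 * H.edgeFinset.card := by
  let r : ℕ → V → Prop := fun t v => if v ∈ X then t < H.degree v else d - t < H.degree v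
  have hcover : ∀ t ∈ Finset.range (d + 1), d ≤ (Finset.univ.bipartiteAbove r t).card := by
    intro t ht
    rw [Finset.mem_range] at ht
    rw [← Set.ncard_coe_finset]
    apply hcov
    have key : ∀ u v, H.Adj u v → u ∈ X → v ∉ X → r t u ∨ r t v := by
      intro u v huv hu hv
      have := hdeg u v huv
      simp only [r, if_pos hu, if_neg hv]
      omega
    intro u v huv
    simp only [Finset.coe_bipartiteAbove, Finset.mem_univ, true_and, Set.mem_ofPred_eq]
    rcases hX.mem_of_adj huv with ⟨hu, hv⟩ | ⟨hu, hv⟩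
    · exact key u v huv hu hv
    · exact (key v u huv.symm hv hu).symm
  have hcount : ∀ v, ((Finset.range (d + 1)).bipartiteBelow r v).card ≤ H.degree v := by
    intro v
    suffices h : ((Finset.range (d + 1)).bipartiteBelow r v).card ≤
        (Finset.range (H.degree v)).card by simpa using h
    by_cases hv : v ∈ X
    · refine Finset.card_le_card fun t ht => ?_
      simpa [r, hv] using (Finset.mem_filter.mp ht).2
    · refine Finset.card_le_card_of_injOn (fun t => d - t) (fun t ht => ?_) fun s hs t ht hst => ?_
      · simpa [r, hv] using (Finset.mem_filter.mp ht).2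
      · have h1 := Finset.mem_range.mp (Finset.mem_filter.mp hs).1
        have h2 := Finset.mem_range.mp (Finset.mem_filter.mp ht).1
        simp only at hst
        omega
  calc (d + 1) * d = ∑ _t ∈ Finset.range (d + 1), d := by simp
    _ ≤ ∑ t ∈ Finset.range (d + 1), (Finset.univ.bipartiteAbove r t).card :=
      Finset.sum_le_sum hcover
    _ = ∑ v, ((Finset.range (d + 1)).bipartiteBelow r v).card :=
      Finset.sum_card_bipartiteAbove_eq_sum_card_bipartiteBelow r
    _ ≤ ∑ v, H.degree v := Finset.sum_le_sum fun v _ => hcount v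
    _ = 2 * H.edgeFinset.card := H.sum_degrees_eq_twice_card_edges

open Classical in
/-- Every common neighbour of the ends of a crossing edge gives a further crossing edge at one of
its ends. -/
theorem le_degree_add_degree_cutGraph {G : SimpleGraph V} {X : Set V} {x y : V}
    (hxy : (cutGraph G X).Adj x y) :
    (G.commonNeighbors x y).ncard + 2 ≤ (cutGraph G X).degree x + (cutGraph G X).degree y := by
  have hsub : (G.commonNeighbors x y) ⊆
      (((cutGraph G X).neighborFinset x).erase y ∪ ((cutGraph G X).neighborFinset y).erase x :
        Finset V) := by
    rintro z ⟨hxz, hyz⟩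
    rw [SimpleGraph.mem_neighborSet] at hxz hyz
    have hX := hxy.2
    simp only [Finset.coe_union, Finset.coe_erase, SimpleGraph.coe_neighborFinset, Set.mem_union,
      Set.mem_sdiff, SimpleGraph.mem_neighborSet, Set.mem_singleton_iff]
    by_cases hz : x ∈ X ↔ z ∉ X
    · exact Or.inl ⟨⟨hxz, hz⟩, hyz.ne'⟩
    · exact Or.inr ⟨⟨hyz, by tauto⟩, hxz.ne'⟩
  have h1 := Set.ncard_le_ncard hsub (Finset.finite_toSet _)
  rw [Set.ncard_coe_finset] at h1
  have h2 := Finset.card_union_le (((cutGraph G X).neighborFinset x).erase y)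
    (((cutGraph G X).neighborFinset y).erase x)
  rw [Finset.card_erase_of_mem (by simpa using hxy),
    Finset.card_erase_of_mem (by simpa using hxy.symm), SimpleGraph.card_neighborFinset_eq_degree,
    SimpleGraph.card_neighborFinset_eq_degree] at h2
  have h3 := (SimpleGraph.degree_pos_iff_exists_adj (cutGraph G X) x).mpr ⟨y, hxy⟩
  have h4 := (SimpleGraph.degree_pos_iff_exists_adj (cutGraph G X) y).mpr ⟨x, hxy.symm⟩
  omega

open Classical in
/-- At most one edge is incident with both of two distinct vertices. -/
theorem degree_add_degree_le_card_edgeFinset {H : SimpleGraph V} {x y : V} (hxy : x ≠ y) :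
    H.degree x + H.degree y ≤ H.edgeFinset.card + 1 := by
  rw [← H.card_incidenceFinset_eq_degree, ← H.card_incidenceFinset_eq_degree,
    ← Finset.card_union_add_card_inter]
  refine Nat.add_le_add (Finset.card_le_card (Finset.union_subset (H.incidenceFinset_subset x)
    (H.incidenceFinset_subset y))) ?_
  rw [← Finset.card_singleton s(x, y)]
  refine Finset.card_le_card fun e he => ?_
  rw [Finset.mem_inter, SimpleGraph.mem_incidenceFinset, SimpleGraph.mem_incidenceFinset] at he
  exact Finset.mem_singleton.mpr (H.incidenceSet_inter_incidenceSet_subset hxy he)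

open Classical in
/-- If no degree is smaller than the number `k` of edges leaving `X`, and `X` has at least two
vertices, then `X` has at least `k` vertices: the degree sum over `X` is at most
`|X| (|X| - 1) + k`. -/
theorem card_edgeFinset_cutGraph_le {G : SimpleGraph V} {X : Set V} (hX : 1 < X.ncard)
    (hmin : ∀ v, (cutGraph G X).edgeFinset.card ≤ G.degree v) :
    (cutGraph G X).edgeFinset.card ≤ X.ncard := by
  set k := (cutGraph G X).edgeFinset.card
  have hdeg : ∀ v ∈ X.toFinset, k ≤ (X.ncard - 1) + (cutGraph G X).degree v := by
    intro v hv
    refine (hmin v).trans ?_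
    rw [← G.card_neighborFinset_eq_degree, ← (cutGraph G X).card_neighborFinset_eq_degree,
      Set.ncard_eq_toFinset_card', ← Finset.card_erase_of_mem hv]
    refine (Finset.card_le_card fun w hw => ?_).trans (Finset.card_union_le _ _)
    rw [SimpleGraph.mem_neighborFinset] at hw
    rw [Set.mem_toFinset] at hv
    simp only [Finset.mem_union, Finset.mem_erase, Set.mem_toFinset,
      SimpleGraph.mem_neighborFinset]
    by_cases hwX : w ∈ X
    · exact Or.inl ⟨hw.ne', hwX⟩
    · exact Or.inr ⟨hw, iff_of_true hv hwX⟩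
  have hbip : (cutGraph G X).IsBipartiteWith (X.toFinset : Set V) (Xᶜ.toFinset : Set V) := by
    simpa using isBipartiteWith_cutGraph G X
  have hsum := Finset.sum_le_sum hdeg
  rw [Finset.sum_add_distrib, SimpleGraph.isBipartiteWith_sum_degrees_eq_card_edges hbip,
    Finset.sum_const, Finset.sum_const, ← Set.ncard_eq_toFinset_card', smul_eq_mul,
    smul_eq_mul] at hsum
  obtain ⟨n, hn⟩ : ∃ n, X.ncard = n + 2 := ⟨X.ncard - 2, by omega⟩
  rw [hn] at hsum ⊢
  change (n + 2) * k ≤ (n + 2) * (n + 1) + k at hsum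
  have : (n + 1) * k ≤ (n + 1) * (n + 2) := by linarith
  exact Nat.le_of_mul_le_mul_left this n.succ_pos

open Classical in
/-- Under Balinski's connectivity condition and with at least `d - 1` common neighbours for adjacent
vertices, a nontrivial cut not larger than any degree has at least `d (d + 1) / 2` edges. -/
theorem mul_le_two_mul_card_edgeFinset_cutGraph {G : SimpleGraph V} {d : ℕ} (hd : 0 < d)
    (hconn : ∀ C : Set V, C.ncard < d → (G.induce Cᶜ).Preconnected)
    (hcommon : ∀ x y, G.Adj x y → d - 1 ≤ (G.commonNeighbors x y).ncard) {X : Set V}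
    (hX : 1 < X.ncard) (hXc : 1 < Xᶜ.ncard)
    (hmin : ∀ v, (cutGraph G X).edgeFinset.card ≤ G.degree v) :
    (d + 1) * d ≤ 2 * (cutGraph G X).edgeFinset.card := by
  have hdeg : ∀ u v, (cutGraph G X).Adj u v →
      d + 1 ≤ (cutGraph G X).degree u + (cutGraph G X).degree v := by
    intro u v huv
    have h1 := hcommon u v huv.1
    have h2 := le_degree_add_degree_cutGraph huv
    omega
  have hcard : d ≤ (cutGraph G X).edgeFinset.card := by
    obtain ⟨a, ha⟩ := Set.nonempty_of_ncard_ne_zero (by omega : X.ncard ≠ 0)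
    obtain ⟨b, hb⟩ := Set.nonempty_of_ncard_ne_zero (by omega : Xᶜ.ncard ≠ 0)
    obtain ⟨u, v, -, -, huv⟩ := exists_cutGraph_adj (hconn ∅ (by simpa using hd)) ha hb
      (Set.notMem_empty a) (Set.notMem_empty b)
    have h1 := hdeg u v huv
    have h2 := degree_add_degree_le_card_edgeFinset (H := cutGraph G X) huv.ne
    omega
  have hXcard := card_edgeFinset_cutGraph_le hX hmin
  have hXccard : (cutGraph G X).edgeFinset.card ≤ Xᶜ.ncard := by
    have heq : (cutGraph G Xᶜ).edgeFinset.card = (cutGraph G X).edgeFinset.card := by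
      rw [← Set.ncard_coe_finset, ← Set.ncard_coe_finset, SimpleGraph.coe_edgeFinset,
        SimpleGraph.coe_edgeFinset, cutGraph_compl]
    rw [← heq] at hmin ⊢
    exact card_edgeFinset_cutGraph_le hXc hmin
  refine mul_le_two_mul_card_edgeFinset (isBipartiteWith_cutGraph G X) hdeg fun C hC => ?_
  by_contra! hCd
  -- A cover with fewer than `d` vertices contains neither side, so deleting it separates the rest.
  have hexists : ∀ Y : Set V, d ≤ Y.ncard → ∃ a ∈ Y, a ∉ C := fun Y hY => by
    by_contra! h
    have := Set.ncard_le_ncard h (Set.toFinite _)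
    omega
  obtain ⟨a, ha, haC⟩ := hexists X (hcard.trans hXcard)
  obtain ⟨b, hb, hbC⟩ := hexists Xᶜ (hcard.trans hXccard)
  obtain ⟨u, v, hu, hv, huv⟩ := exists_cutGraph_adj (hconn C hCd) ha hb haC hbC
  exact (hC huv).elim hu hv

theorem isTrivialCut_of_ncard_le_one {G : SimpleGraph V} {X : Set V} (hX : X.Nonempty)
    (h : X.ncard ≤ 1) : IsTrivialCut G (edgesBetween G X) := by
  obtain ⟨v, rfl⟩ := Set.ncard_eq_one.mp
    (le_antisymm h ((Set.ncard_pos (Set.toFinite _)).mpr hX))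
  exact ⟨v, edgesBetween_singleton G v⟩

end Cuts
end SimplicialPolytope

/-! ### Minimum edge cuts of simplicial polytopes -/

theorem mainTheorem1 (d n : ℕ) (hd : 3 ≤ d) (P : Set (EuclideanSpace ℝ (Fin n)))
    (hP : SimplicialPolytope.IsSimplicialPolytope d P)
    (D : Set (Sym2 (SimplicialPolytope.Vertex P)))
    (hD : SimplicialPolytope.IsMinimumEdgeCut (SimplicialPolytope.graph P) D)
    (hcard : D.encard ≤ ((4 * d - 7 : ℕ) : ℕ∞)) :
    SimplicialPolytope.IsTrivialCut (SimplicialPolytope.graph P) D := by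
  open SimplicialPolytope in
  classical
  have := hP.isPolytope.finite_vertex
  have : Fintype (Vertex P) := Fintype.ofFinite _
  obtain ⟨⟨X, hXne, hXuniv, rfl⟩, hmin⟩ := hD
  have hXcne : Xᶜ.Nonempty := Set.nonempty_compl.mpr hXuniv
  by_cases hX : X.ncard ≤ 1
  · exact isTrivialCut_of_ncard_le_one hXne hX
  by_cases hXc : Xᶜ.ncard ≤ 1
  · rw [← edgesBetween_compl]
    exact isTrivialCut_of_ncard_le_one hXcne hXc
  have hencard : (edgesBetween (graph P) X).encard = (cutGraph (graph P) X).edgeFinset.card := by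
    rw [← edgeSet_cutGraph, ← SimpleGraph.coe_edgeFinset, Set.encard_coe_eq_coe_finsetCard]
  have hdeg : ∀ v, (cutGraph (graph P) X).edgeFinset.card ≤ (graph P).degree v := by
    intro v
    have hv : ({v} : Set (Vertex P)) ≠ Set.univ := by
      intro h
      have := Set.ncard_le_ncard (h ▸ Set.subset_univ X) (Set.toFinite {v})
      rw [Set.ncard_singleton] at this
      exact hX this
    have h := hmin _ ⟨{v}, Set.singleton_nonempty v, hv, rfl⟩
    rw [hencard, edgesBetween_singleton, ← SimpleGraph.coe_incidenceFinset,
      Set.encard_coe_eq_coe_finsetCard, SimpleGraph.card_incidenceFinset_eq_degree] at h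
    exact_mod_cast h
  have hbound := mul_le_two_mul_card_edgeFinset_cutGraph (G := graph P) (d := d) (by omega)
    (fun C hC => hP.isPolytope.preconnected_induce_compl hP.hasDim hC)
    (fun x y hxy => hP.le_ncard_commonNeighbors hd hxy) (by omega) (by omega) hdeg
  rw [hencard] at hcard
  have hcard' : (cutGraph (graph P) X).edgeFinset.card ≤ 4 * d - 7 := by exact_mod_cast hcard
  -- `(d + 1) * d ≤ 2 * (4 * d - 7)` has no solution.
  exfalso
  zify [show 7 ≤ 4 * d by omega] at hbound hcard'
  nlinarith [sq_nonneg (2 * (d : ℤ) - 7)]
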